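/- Let $X=\mathbb R\times S^1$, with $S^1=\mathbb R/2\pi\mathbb Z$, carry the measure $dx\,dy$, and let $L^2_0(X)$ be the orthogonal complement in the complex Hilbert space $L^2(X)$ of the functions that depend only on $x$, that is, the space of $u\in L^2(X)$ with $\int_{S^1}u(x,y)\,dy=0$ for almost every $x$. Let $V:\mathbb R\to[0,\infty)$ be continuous with $V(x)\to+\infty$ as $|x|\to\infty$ (for example $V(x)=|x|^{2\gamma}W(x)$ with $\gamma>0$ and $W\ge 1$ bounded and continuous). Let $P_V$ be the closure in $L^2_0(X)$ of the operator $-\partial_x^2-V(x)\partial_y^2$ whose domain is the set of smooth compactly supported functions in $L^2_0(X)$; this operator is essentially self-adjoint, so $P_V$ is its unique self-adjoint extension. Suppose that every eigenvalue $E$ of $P_V$ has multiplicity two, i.e. $\dim_{\mathbb C}\ker(P_V-E)=2$. Then for all real $a<b$, writing $w=\mathbb R\times{]a,b[}\subset X$ for the horizontal strip of points $(x,\,y \bmod 2\pi)$ with $x\in\mathbb R$ and $a<y<b$, there is a constant $C>0$ such that for every $E\in\mathbb R$ and every $\varphi\in\ker(P_V-E)$, $$\|\varphi\|_{L^2(X)}\le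 C\,\|\varphi\|_{L^2(w)}.$$ -/

import Mathlib

open MeasureTheory Filter Topology
open scoped ContDiff

noncomputable section

namespace Grushin

instance instFactTwoPiPos : Fact ((0 : ℝ) < 2 * Real.pi) := ⟨Real.two_pi_pos⟩

/-- The circle `ℝ / 2πℤ`. Its measure `volume` is Lebesgue measure, of total mass `2π`. -/
abbrev Circ : Type := AddCircle (2 * Real.pi)

/-- The infinite cylinder `X = ℝ × S¹`, with the measure `volume`, that is, `dx dy`. -/
abbrev Cyl : Type := ℝ × Circ

/-- The covering map `ℝ × ℝ → X`. -/
def cover (q : ℝ × ℝ) : Cyl := (q.1, (q.2 : Circ))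

/-- The complex Hilbert space `L²(X)`. -/
abbrev L2X : Type := Lp ℂ 2 (volume : Measure Cyl)

/-- The elements of `L²(X)` that depend only on the first variable. -/
def xOnly : Submodule ℂ L2X where
  carrier := {u | ∃ g : ℝ → ℂ, (u : Cyl → ℂ) =ᵐ[volume] fun p => g p.1}
  zero_mem' := ⟨0, Lp.coeFn_zero ℂ 2 (volume : Measure Cyl)⟩
  add_mem' := by
    rintro u v ⟨g, hg⟩ ⟨h, hh⟩
    refine ⟨fun x => g x + h x, ?_⟩
    filter_upwards [Lp.coeFn_add u v, hg, hh] with p h1 h2 h3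
    rw [h1, Pi.add_apply, h2, h3]
  smul_mem' := by
    rintro c u ⟨g, hg⟩
    refine ⟨fun x => c * g x, ?_⟩
    filter_upwards [Lp.coeFn_smul c u, hg] with p h1 h2
    rw [h1, Pi.smul_apply, h2, smul_eq_mul]

/-- `L²₀(X)`: the orthogonal complement in `L²(X)` of the functions that depend only on `x`. -/
abbrev L20 : Submodule ℂ L2X := xOnlyᗮ

/-- The partial derivative `∂ₓ f`. -/
def dx (f : Cyl → ℂ) (p : Cyl) : ℂ := deriv (fun x : ℝ => f (x, p.2)) p.1

/-- The partial derivative `∂_y f` along the circle. -/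
def dy (f : Cyl → ℂ) (p : Cyl) : ℂ := deriv (fun t : ℝ => f (p.1, p.2 + (t : Circ))) 0

/-- The differential expression `- ∂ₓ² f - V(x) ∂_y² f`. -/
def grushinExpr (V : ℝ → ℝ) (f : Cyl → ℂ) (p : Cyl) : ℂ :=
  - dx (dx f) p - (V p.1 : ℂ) * dy (dy f) p

/-- `f` is a smooth function on `X` with compact support and with
`∫ f(x, y) dy = 0` for every `x`. -/
structure IsTest (f : Cyl → ℂ) : Prop where
  smooth : ContDiff ℝ ∞ (f ∘ cover)
  compactSupp : HasCompactSupport f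
  mean_zero : ∀ x : ℝ, ∫ θ : Circ, f (x, θ) = 0

section Calculus

theorem continuous_of_cover {f : Cyl → ℂ} (h : Continuous (f ∘ cover)) : Continuous f := by
  have h1 : IsOpenQuotientMap (cover : ℝ × ℝ → Cyl) :=
    IsOpenQuotientMap.id.prodMap QuotientAddGroup.isOpenQuotientMap_mk
  exact h1.continuous_comp_iff.1 h

theorem IsTest.continuous {f : Cyl → ℂ} (h : IsTest f) : Continuous f :=
  continuous_of_cover h.smooth.continuous

theorem hasDerivAt_dx {f : Cyl → ℂ} (h : ContDiff ℝ ∞ (f ∘ cover)) (x : ℝ) (θ : Circ) :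
    HasDerivAt (fun x : ℝ => f (x, θ)) (dx f (x, θ)) x := by
  obtain ⟨y, rfl⟩ := QuotientAddGroup.mk_surjective θ
  have h1 : DifferentiableAt ℝ (fun x : ℝ => (f ∘ cover) (x, y)) x :=
    (h.differentiable (by simp) (x, y)).comp x (f := fun x : ℝ => (x, y)) (by fun_prop)
  exact h1.hasDerivAt

theorem hasDerivAt_dy {f : Cyl → ℂ} (h : ContDiff ℝ ∞ (f ∘ cover)) (x y : ℝ) :
    HasDerivAt (fun y : ℝ => f (x, (y : Circ))) (dy f (x, (y : Circ))) y := by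
  have h1 : DifferentiableAt ℝ (fun y : ℝ => (f ∘ cover) (x, y)) y :=
    (h.differentiable (by simp) (x, y)).comp y (f := fun y : ℝ => (x, y)) (by fun_prop)
  have h2 : HasDerivAt (fun y : ℝ => f (x, (y : Circ))) _ y := h1.hasDerivAt
  have h3 : dy f (x, (y : Circ)) = deriv (fun t : ℝ => f (x, ((y + t : ℝ) : Circ))) 0 := by
    simp only [dy, AddCircle.coe_add]
  have h4 := deriv_comp_const_add (fun t : ℝ => f (x, (t : Circ))) y 0
  rw [h3, h4, add_zero]
  exact h2.differentiableAt.hasDerivAt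

theorem dx_comp_cover {f : Cyl → ℂ} (h : ContDiff ℝ ∞ (f ∘ cover)) (q : ℝ × ℝ) :
    dx f (cover q) = fderiv ℝ (f ∘ cover) q (1, 0) := by
  have h1 := (h.differentiable (by simp) q).hasFDerivAt.comp_hasDerivAt q.1
    ((hasDerivAt_id q.1).prodMk (hasDerivAt_const q.1 q.2))
  exact (hasDerivAt_dx h q.1 (q.2 : Circ)).unique h1

theorem dy_comp_cover {f : Cyl → ℂ} (h : ContDiff ℝ ∞ (f ∘ cover)) (q : ℝ × ℝ) :
    dy f (cover q) = fderiv ℝ (f ∘ cover) q (0, 1) := by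
  have h1 := (h.differentiable (by simp) q).hasFDerivAt.comp_hasDerivAt q.2
    ((hasDerivAt_const q.2 q.1).prodMk (hasDerivAt_id q.2))
  exact (hasDerivAt_dy h q.1 q.2).unique h1

theorem smooth_dx {f : Cyl → ℂ} (h : ContDiff ℝ ∞ (f ∘ cover)) :
    ContDiff ℝ ∞ (dx f ∘ cover) := by
  have h1 : dx f ∘ cover = fun q => fderiv ℝ (f ∘ cover) q (1, 0) :=
    funext fun q => dx_comp_cover h q
  rw [h1]
  exact (h.fderiv_right (by simp)).clm_apply contDiff_const

theorem smooth_dy {f : Cyl → ℂ} (h : ContDiff ℝ ∞ (f ∘ cover)) :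
    ContDiff ℝ ∞ (dy f ∘ cover) := by
  have h1 : dy f ∘ cover = fun q => fderiv ℝ (f ∘ cover) q (0, 1) :=
    funext fun q => dy_comp_cover h q
  rw [h1]
  exact (h.fderiv_right (by simp)).clm_apply contDiff_const

theorem compactSupp_dx {f : Cyl → ℂ} (h : HasCompactSupport f) : HasCompactSupport (dx f) := by
  refine h.mono' fun p hp => ?_
  by_contra hn
  apply hp
  have h1 : f =ᶠ[𝓝 p] 0 := notMem_tsupport_iff_eventuallyEq.1 hn
  have h2 : Tendsto (fun x : ℝ => ((x, p.2) : Cyl)) (𝓝 p.1) (𝓝 p) :=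
    Continuous.tendsto (f := fun x : ℝ => ((x, p.2) : Cyl)) (by fun_prop) p.1
  have h3 : (fun x : ℝ => f (x, p.2)) =ᶠ[𝓝 p.1] fun _ => 0 := h2.eventually h1
  simpa [dx] using h3.deriv_eq

theorem compactSupp_dy {f : Cyl → ℂ} (h : HasCompactSupport f) : HasCompactSupport (dy f) := by
  refine h.mono' fun p hp => ?_
  by_contra hn
  apply hp
  have h1 : f =ᶠ[𝓝 p] 0 := notMem_tsupport_iff_eventuallyEq.1 hn
  have h2 : Tendsto (fun t : ℝ => ((p.1, p.2 + (t : Circ)) : Cyl)) (𝓝 0) (𝓝 p) := by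
    have hc : Continuous (fun t : ℝ => ((p.1, p.2 + (t : Circ)) : Cyl)) :=
      continuous_const.prodMk (continuous_const.add (AddCircle.continuous_mk' _))
    simpa using hc.tendsto 0
  have h3 : (fun t : ℝ => f (p.1, p.2 + (t : Circ))) =ᶠ[𝓝 0] fun _ => 0 := h2.eventually h1
  simpa [dy] using h3.deriv_eq

theorem IsTest.dx {f : Cyl → ℂ} (h : IsTest f) : IsTest (dx f) where
  smooth := smooth_dx h.smooth
  compactSupp := compactSupp_dx h.compactSupp
  mean_zero := by
    intro x
    have hc : Continuous (Grushin.dx f) := continuous_of_cover (smooth_dx h.smooth).continuous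
    obtain ⟨M, hM⟩ := (compactSupp_dx h.compactSupp).exists_bound_of_continuous hc
    have hs : ∀ g : Cyl → ℂ, Continuous g → ∀ z : ℝ, Continuous fun θ : Circ => g (z, θ) :=
      fun g hg z => hg.comp (by fun_prop)
    have key := (hasDerivAt_integral_of_dominated_loc_of_deriv_le
      (μ := (volume : Measure Circ)) (F := fun (x : ℝ) (θ : Circ) => f (x, θ))
      (F' := fun (x : ℝ) (θ : Circ) => Grushin.dx f (x, θ)) (x₀ := x) (s := Set.univ)
      (bound := fun _ => M) univ_mem
      (Eventually.of_forall fun z => (hs f h.continuous z).aestronglyMeasurable)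
      ((hs f h.continuous x).integrable_of_hasCompactSupport
        (HasCompactSupport.of_compactSpace _))
      (hs _ hc x).aestronglyMeasurable
      (Eventually.of_forall fun θ z _ => hM (z, θ))
      (integrable_const M)
      (Eventually.of_forall fun θ z _ => hasDerivAt_dx h.smooth z θ)).2
    simp only [h.mean_zero] at key
    exact key.unique (hasDerivAt_const x 0)

theorem IsTest.dy {f : Cyl → ℂ} (h : IsTest f) : IsTest (dy f) where
  smooth := smooth_dy h.smooth
  compactSupp := compactSupp_dy h.compactSupp
  mean_zero := by
    intro x
    have hc : Continuous (Grushin.dy f ∘ cover) := (smooth_dy h.smooth).continuous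
    rw [← AddCircle.intervalIntegral_preimage (2 * Real.pi) 0]
    have hc' : Continuous fun y : ℝ => Grushin.dy f (x, (y : Circ)) :=
      hc.comp (f := fun y : ℝ => (x, y)) (by fun_prop)
    rw [intervalIntegral.integral_eq_sub_of_hasDerivAt
      (fun y _ => hasDerivAt_dy h.smooth x y) (hc'.intervalIntegrable _ _)]
    rw [zero_add, AddCircle.coe_period, QuotientAddGroup.mk_zero, sub_self]

theorem dx_add {f g : Cyl → ℂ} (hf : IsTest f) (hg : IsTest g) : dx (f + g) = dx f + dx g :=
  funext fun p =>
    ((hasDerivAt_dx hf.smooth p.1 p.2).add (hasDerivAt_dx hg.smooth p.1 p.2)).deriv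

theorem dx_smul (c : ℂ) (f : Cyl → ℂ) : dx (c • f) = c • dx f :=
  funext fun p => deriv_const_smul_field c (fun x : ℝ => f (x, p.2))

theorem dy_smul (c : ℂ) (f : Cyl → ℂ) : dy (c • f) = c • dy f :=
  funext fun p => deriv_const_smul_field c (fun t : ℝ => f (p.1, p.2 + (t : Circ)))

theorem IsTest.add {f g : Cyl → ℂ} (hf : IsTest f) (hg : IsTest g) : IsTest (f + g) where
  smooth := hf.smooth.add hg.smooth
  compactSupp := hf.compactSupp.add hg.compactSupp
  mean_zero := by
    intro x
    have hi : ∀ g : Cyl → ℂ, IsTest g → Integrable fun θ : Circ => g (x, θ) :=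
      fun g hg => (hg.continuous.comp (by fun_prop : Continuous fun θ : Circ => ((x, θ) : Cyl))
        ).integrable_of_hasCompactSupport (HasCompactSupport.of_compactSpace _)
    simp only [Pi.add_apply]
    rw [integral_add (hi f hf) (hi g hg), hf.mean_zero, hg.mean_zero, add_zero]

theorem IsTest.smul (c : ℂ) {f : Cyl → ℂ} (hf : IsTest f) : IsTest (c • f) where
  smooth := hf.smooth.const_smul c
  compactSupp := hf.compactSupp.smul_left (f := fun _ => c)
  mean_zero := by
    intro x
    simp only [Pi.smul_apply]
    rw [integral_smul, hf.mean_zero, smul_zero]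

theorem dy_add {f g : Cyl → ℂ} (hf : IsTest f) (hg : IsTest g) : dy (f + g) = dy f + dy g := by
  funext p
  obtain ⟨x, θ⟩ := p
  obtain ⟨y, rfl⟩ := QuotientAddGroup.mk_surjective θ
  have h := (hasDerivAt_dy hf.smooth x y).add (hasDerivAt_dy hg.smooth x y)
  exact (hasDerivAt_dy (hf.add hg).smooth x y).unique h

/-- A continuous compactly supported function whose integrals over the circles
`{x} × S¹` all vanish. -/
structure IsMeanZero (f : Cyl → ℂ) : Prop where
  continuous : Continuous f
  compactSupp : HasCompactSupport f
  mean_zero : ∀ x : ℝ, ∫ θ : Circ, f (x, θ) = 0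

theorem IsTest.isMeanZero {f : Cyl → ℂ} (h : IsTest f) : IsMeanZero f :=
  ⟨h.continuous, h.compactSupp, h.mean_zero⟩

theorem IsTest.grushinExpr {V : ℝ → ℝ} (hV : Continuous V) {f : Cyl → ℂ} (h : IsTest f) :
    IsMeanZero (grushinExpr V f) where
  continuous := by
    have h1 := h.dx.dx.continuous
    have h2 := h.dy.dy.continuous
    unfold Grushin.grushinExpr
    fun_prop
  compactSupp := by
    have h1 : HasCompactSupport fun p : Cyl => (V p.1 : ℂ) * Grushin.dy (Grushin.dy f) p :=
      h.dy.dy.compactSupp.mul_left (f := fun p : Cyl => (V p.1 : ℂ))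
    exact h.dx.dx.compactSupp.neg.sub h1
  mean_zero := by
    intro x
    have hi : ∀ g : Cyl → ℂ, IsTest g → Integrable fun θ : Circ => g (x, θ) :=
      fun g hg => (hg.continuous.comp (by fun_prop : Continuous fun θ : Circ => ((x, θ) : Cyl))
        ).integrable_of_hasCompactSupport (HasCompactSupport.of_compactSpace _)
    simp only [Grushin.grushinExpr]
    have h1 := integral_sub (hi _ h.dx.dx).neg ((hi _ h.dy.dy).const_mul (V x : ℂ))
    simp only [Pi.neg_apply] at h1
    rw [h1, integral_neg, integral_const_mul, h.dx.dx.mean_zero, h.dy.dy.mean_zero]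
    simp

theorem IsMeanZero.memLp {f : Cyl → ℂ} (h : IsMeanZero f) : MemLp f 2 (volume : Measure Cyl) :=
  h.continuous.memLp_of_hasCompactSupport h.compactSupp

theorem IsMeanZero.mem_L20 {f : Cyl → ℂ} (h : IsMeanZero f) : h.memLp.toLp f ∈ L20 := by
  rw [Submodule.mem_orthogonal]
  rintro u ⟨g, hg⟩
  have hae : (fun p : Cyl => inner ℂ (u p) (h.memLp.toLp f p)) =ᵐ[volume]
      fun p : Cyl => f p * star (g p.1) := by
    filter_upwards [hg, h.memLp.coeFn_toLp] with p h1 h2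
    rw [h1, h2]
    simp [RCLike.inner_apply]
  have hint : Integrable (fun p : Cyl => f p * star (g p.1)) (volume : Measure Cyl) :=
    (integrable_congr hae).1 (L2.integrable_inner u (h.memLp.toLp f))
  rw [L2.inner_def, integral_congr_ae hae]
  rw [Measure.volume_eq_prod] at hint ⊢
  rw [integral_prod _ hint]
  simp [integral_mul_const, h.mean_zero]

/-- The class in `L²₀(X)` of such a function. -/
def IsMeanZero.toL20 {f : Cyl → ℂ} (h : IsMeanZero f) : L20 := ⟨h.memLp.toLp f, h.mem_L20⟩

theorem IsMeanZero.coe_toL20 {f : Cyl → ℂ} (h : IsMeanZero f) :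
    ((h.toL20 : L2X) : Cyl → ℂ) =ᵐ[volume] f := h.memLp.coeFn_toLp

end Calculus

/-- The space of smooth compactly supported functions on `X` with vanishing mean in `y`. -/
def testSpace : Submodule ℂ (Cyl → ℂ) where
  carrier := {f | IsTest f}
  zero_mem' :=
    { smooth := contDiff_const
      compactSupp := HasCompactSupport.zero
      mean_zero := by simp }
  add_mem' hf hg := hf.add hg
  smul_mem' c _ hf := hf.smul c

/-- The inclusion of test functions in `L²₀(X)`. -/
def testToL20 : testSpace →ₗ[ℂ] L20 where
  toFun f := IsMeanZero.toL20 (f := f.1) (IsTest.isMeanZero f.2)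
  map_add' _ _ := rfl
  map_smul' _ _ := rfl

theorem testToL20_injective : Function.Injective testToL20 := by
  intro f g hfg
  have hf : IsTest f.1 := f.2
  have hg : IsTest g.1 := g.2
  have h1 : (f : Cyl → ℂ) =ᵐ[volume] (g : Cyl → ℂ) := by
    have h2 := hf.isMeanZero.coe_toL20
    have h3 := hg.isMeanZero.coe_toL20
    have h4 : hf.isMeanZero.toL20 = hg.isMeanZero.toL20 := hfg
    rw [h4] at h2
    exact h2.symm.trans h3
  exact Subtype.ext (Measure.eq_of_ae_eq h1 hf.continuous hg.continuous)

/-- The map `f ↦ - ∂ₓ² f - V ∂_y² f` from test functions to `L²₀(X)`. -/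
def grushinTest (V : C(ℝ, ℝ)) : testSpace →ₗ[ℂ] L20 where
  toFun f := (IsTest.grushinExpr V.continuous (f := f.1) f.2).toL20
  map_add' f g := by
    have hf : IsTest f.1 := f.2
    have hg : IsTest g.1 := g.2
    have h : grushinExpr V (f.1 + g.1) = grushinExpr V f.1 + grushinExpr V g.1 := by
      funext p
      simp only [grushinExpr, Pi.add_apply, dx_add hf hg, dy_add hf hg, dx_add hf.dx hg.dx,
        dy_add hf.dy hg.dy]
      ring
    refine Subtype.ext ?_
    change (IsTest.grushinExpr V.continuous (hf.add hg)).memLp.toLp _ =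
      (hf.grushinExpr V.continuous).memLp.toLp _ + (hg.grushinExpr V.continuous).memLp.toLp _
    rw [← MemLp.toLp_add]
    exact MemLp.toLp_congr _ _ (Eventually.of_forall fun p => congrFun h p)
  map_smul' c f := by
    have hf : IsTest f.1 := f.2
    have h : grushinExpr V (c • f.1) = c • grushinExpr V f.1 := by
      funext p
      simp only [grushinExpr, Pi.smul_apply, dx_smul, dy_smul, smul_eq_mul]
      ring
    refine Subtype.ext ?_
    change (IsTest.grushinExpr V.continuous (hf.smul c)).memLp.toLp _ =
      c • (hf.grushinExpr V.continuous).memLp.toLp _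
    rw [← MemLp.toLp_const_smul]
    exact MemLp.toLp_congr _ _ (Eventually.of_forall fun p => congrFun h p)

/-- The operator `- ∂ₓ² - V(x) ∂_y²` on `L²₀(X)`, with the test functions as its domain. -/
def grushinMin (V : C(ℝ, ℝ)) : L20 →ₗ.[ℂ] L20 where
  domain := LinearMap.range testToL20
  toFun := grushinTest V ∘ₗ
    (LinearEquiv.ofInjective testToL20 testToL20_injective).symm.toLinearMap

/-- The Baouendi-Grushin operator `P_V` on `L²₀(X)`: the closure of `- ∂ₓ² - V(x) ∂_y²` on test
functions. That operator is essentially self-adjoint, so its closure is its unique self-adjoint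
extension. -/
def grushin (V : C(ℝ, ℝ)) : L20 →ₗ.[ℂ] L20 := (grushinMin V).closure

/-- `ker (P_V - E)`, the space of all `u` in the domain of `P_V` with `P_V u = E u`. -/
def eigenspace (V : C(ℝ, ℝ)) (E : ℝ) : Submodule ℂ L20 where
  carrier := {u | ∃ hu : u ∈ (grushin V).domain, grushin V ⟨u, hu⟩ = (E : ℂ) • u}
  zero_mem' := ⟨zero_mem _, by
    rw [smul_zero]; exact (grushin V).map_zero⟩
  add_mem' := by
    rintro u v ⟨hu, hu'⟩ ⟨hv, hv'⟩
    refine ⟨add_mem hu hv, ?_⟩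
    rw [smul_add, ← hu', ← hv', ← LinearPMap.map_add]
    rfl
  smul_mem' := by
    rintro c u ⟨hu, hu'⟩
    refine ⟨Submodule.smul_mem _ c hu, ?_⟩
    rw [smul_comm, ← hu', ← LinearPMap.map_smul]
    rfl

/-- `E` is an eigenvalue of `P_V`. -/
def IsEigenvalue (V : C(ℝ, ℝ)) (E : ℝ) : Prop := eigenspace V E ≠ ⊥

/-- The horizontal strip `ℝ × ]a, b[` of the cylinder. -/
def strip (a b : ℝ) : Set Cyl := {p | p.2 ∈ (fun t : ℝ => (t : Circ)) '' Set.Ioo a b}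

end Grushin

end

/-!
The operator `P_V` commutes with the rotations `u(x, y) ↦ u(x, y + t)` of the cylinder and with the
reflection `u(x, y) ↦ u(x, -y)`: both preserve test functions and commute with the differential
expression, hence they preserve the graph of the closure (`map_mem_graph_closure`) and every
eigenspace (`IsFibreSymmetry.pull_mem_eigenspaceL2`).

An eigenspace of dimension two is closed, so if it contains `φ ≠ 0` it contains the Fourier
coefficients of `t ↦ rot t φ`, one of which is a nonzero mode `u(x, y) = f(x) exp(i n y)`
(`exists_isMode`). Here `n ≠ 0`, since functions of `x` alone are orthogonal to `L²₀(X)`. The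
reflection of `u` is a mode for `-n`, it lies in the same eigenspace, and it is orthogonal to `u`;
by the dimension hypothesis the two span the eigenspace (`exists_add_of_mem_eigenspaceL2`).

The estimate is therefore one for functions `f(x) (α exp(i n y) + β exp(-i n y))`, with a constant
independent of `n`. Averaging over rotations computes the integral of a product of modes over the
strip as a Fourier coefficient of the arc `]a, b[` times an integral over `X`
(`integral_weight_mul`). With `L = b - a ≤ 2π`, the diagonal terms carry the factor `L / 2π` and the
cross terms a factor of modulus `|sin (n L)| / (2π |n|) ≤ |sin L| / 2π`. As `|sin L| < L`, the mass
of the strip is at least `(L - |sin L|) / 2π` times the total mass (`norm_le_strip`).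
-/

noncomputable section

namespace Grushin

/-! ### Symmetries of the cylinder acting on the fibres -/

/-- The map of the cylinder that acts by `σ` on every circle `{x} × S¹`. -/
def fibreMap (σ : Circ → Circ) (p : Cyl) : Cyl := (p.1, σ p.2)

theorem measurePreserving_fibreMap {σ : Circ → Circ} (hσ : MeasurePreserving σ) :
    MeasurePreserving (fibreMap σ) :=
  (MeasurePreserving.id (volume : Measure ℝ)).prod hσ

/-- Composition with `fibreMap σ`, as a linear isometry of `L²(X)`. -/
def pull (σ : Circ → Circ) (hσ : MeasurePreserving σ) : L2X →ₗᵢ[ℂ] L2X :=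
  Lp.compMeasurePreservingₗᵢ ℂ (fibreMap σ) (measurePreserving_fibreMap hσ)

theorem coeFn_pull {σ : Circ → Circ} (hσ : MeasurePreserving σ) (u : L2X) :
    (pull σ hσ u : Cyl → ℂ) =ᵐ[volume] fun p => u (p.1, σ p.2) :=
  Lp.coeFn_compMeasurePreserving u (measurePreserving_fibreMap hσ)

theorem pull_eq_self {σ : Circ → Circ} (hσ : MeasurePreserving σ) {w : L2X} (hw : w ∈ xOnly) :
    pull σ hσ w = w := by
  obtain ⟨g, hg⟩ := hw
  refine Lp.ext ?_
  filter_upwards [coeFn_pull hσ w, hg,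
    (measurePreserving_fibreMap hσ).quasiMeasurePreserving.ae hg] with p h1 h2 h3
  rw [h1, h2]
  exact h3

theorem pull_mem_L20 {σ : Circ → Circ} (hσ : MeasurePreserving σ) {u : L2X} (hu : u ∈ L20) :
    pull σ hσ u ∈ L20 := by
  rw [Submodule.mem_orthogonal] at hu ⊢
  intro w hw
  rw [← hu w hw, ← (pull σ hσ).inner_map_map w u, pull_eq_self hσ hw]

/-- The restriction of `pull σ` to `L²₀(X)`. -/
def pullL20 (σ : Circ → Circ) (hσ : MeasurePreserving σ) : L20 →L[ℂ] L20 :=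
  ((pull σ hσ).toContinuousLinearMap ∘L L20.subtypeL).codRestrict L20
    fun u => pull_mem_L20 hσ u.2

/-- `σ` preserves the measure of the circle, and composition with `fibreMap σ` preserves test
functions and commutes with the differential expressions `- ∂ₓ² - V ∂_y²`. -/
structure IsFibreSymmetry (σ : Circ → Circ) : Prop where
  measurePreserving : MeasurePreserving σ
  isTest_comp : ∀ f : Cyl → ℂ, IsTest f → IsTest (f ∘ fibreMap σ)
  grushinExpr_comp : ∀ (V : ℝ → ℝ) (f : Cyl → ℂ),
    grushinExpr V (f ∘ fibreMap σ) = grushinExpr V f ∘ fibreMap σ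

theorem dy_comp_add (f : Cyl → ℂ) (t : Circ) :
    dy (f ∘ fibreMap (· + t)) = dy f ∘ fibreMap (· + t) := by
  funext p
  simp only [dy, fibreMap, Function.comp_apply]
  congr 1
  funext s
  rw [add_right_comm]

theorem dy_comp_neg (f : Cyl → ℂ) :
    dy (f ∘ fibreMap Neg.neg) = fun p => - dy f (fibreMap Neg.neg p) := by
  funext p
  have h := deriv_comp_neg (fun s : ℝ => f (p.1, -p.2 + (s : Circ))) 0
  simp only [dy, fibreMap, Function.comp_apply]
  rw [neg_zero] at h
  rw [← h]
  congr 1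
  funext s
  rw [neg_add, AddCircle.coe_neg]

theorem dy_neg (f : Cyl → ℂ) : dy (fun p => - f p) = fun p => - dy f p := by
  funext p
  exact deriv.fun_neg

theorem isFibreSymmetry_add (t : Circ) : IsFibreSymmetry (· + t) where
  measurePreserving := measurePreserving_add_right volume t
  isTest_comp f hf :=
    { smooth := by
        obtain ⟨s, rfl⟩ := QuotientAddGroup.mk_surjective t
        have h : (f ∘ fibreMap (· + (s : Circ))) ∘ cover =
            (f ∘ cover) ∘ fun q : ℝ × ℝ => (q.1, q.2 + s) := by
          funext q
          simp [fibreMap, cover]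
        exact h ▸ hf.smooth.comp (by fun_prop)
      compactSupp := hf.compactSupp.comp_homeomorph
        ((Homeomorph.refl ℝ).prodCongr (Homeomorph.addRight t))
      mean_zero := fun x => by
        rw [← hf.mean_zero x]
        exact integral_add_right_eq_self (fun θ : Circ => f (x, θ)) t }
  grushinExpr_comp V f := by
    funext p
    simp only [grushinExpr, dy_comp_add]
    rfl

theorem isFibreSymmetry_neg : IsFibreSymmetry Neg.neg where
  measurePreserving := Measure.measurePreserving_neg volume
  isTest_comp f hf :=
    { smooth := by
        have h : (f ∘ fibreMap Neg.neg) ∘ cover =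
            (f ∘ cover) ∘ fun q : ℝ × ℝ => (q.1, -q.2) := by
          funext q
          simp [fibreMap, cover]
        exact h ▸ hf.smooth.comp (by fun_prop)
      compactSupp := hf.compactSupp.comp_homeomorph
        ((Homeomorph.refl ℝ).prodCongr (Homeomorph.neg Circ))
      mean_zero := fun x => by
        rw [← hf.mean_zero x]
        exact integral_neg_eq_self (fun θ : Circ => f (x, θ)) volume }
  grushinExpr_comp V f := by
    have h := dy_comp_neg (dy f)
    funext p
    simp only [grushinExpr, dy_comp_neg, dy_neg]
    rw [show (fun p => dy f (fibreMap Neg.neg p)) = dy f ∘ fibreMap Neg.neg from rfl, h]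
    simp only [neg_neg]
    rfl

/-! ### Invariance of the eigenspaces -/

/-- A continuous linear map that preserves the graph of an unbounded operator preserves the graph
of its closure. By convention an operator that is not closable is its own closure, so closability
plays no role. -/
theorem map_mem_graph_closure {𝕜 H : Type*} [NontriviallyNormedField 𝕜] [NormedAddCommGroup H]
    [NormedSpace 𝕜 H] {f : H →ₗ.[𝕜] H} {T : H →L[𝕜] H}
    (hT : ∀ x y, (x, y) ∈ f.graph → (T x, T y) ∈ f.graph) {x y : H}
    (h : (x, y) ∈ f.closure.graph) : (T x, T y) ∈ f.closure.graph := by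
  by_cases hf : f.IsClosable
  · rw [← hf.graph_closure_eq_closure_graph] at h ⊢
    have hmaps : Set.MapsTo (T.prodMap T) (f.graph : Set (H × H)) f.graph :=
      fun p hp => hT p.1 p.2 hp
    exact hmaps.closure (T.prodMap T).continuous h
  · rw [LinearPMap.closure_def' hf] at h ⊢
    exact hT x y h

theorem mem_graph_grushinMin {V : C(ℝ, ℝ)} {x y : L20} :
    (x, y) ∈ (grushinMin V).graph ↔ ∃ f : testSpace, testToL20 f = x ∧ grushinTest V f = y := by
  rw [LinearPMap.mem_graph_iff]
  constructor
  · rintro ⟨⟨_, f, rfl⟩, rfl, rfl⟩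
    refine ⟨f, rfl, ?_⟩
    change _ = grushinTest V ((LinearEquiv.ofInjective testToL20 testToL20_injective).symm _)
    congr 1
    exact ((LinearEquiv.ofInjective testToL20 testToL20_injective).symm_apply_apply f).symm
  · rintro ⟨f, rfl, rfl⟩
    refine ⟨⟨testToL20 f, f, rfl⟩, rfl, ?_⟩
    change grushinTest V ((LinearEquiv.ofInjective testToL20 testToL20_injective).symm _) = _
    congr 1
    exact (LinearEquiv.ofInjective testToL20 testToL20_injective).symm_apply_apply f

theorem mem_eigenspace_iff {V : C(ℝ, ℝ)} {E : ℝ} {u : L20} :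
    u ∈ eigenspace V E ↔ (u, (E : ℂ) • u) ∈ (grushin V).graph := by
  rw [LinearPMap.mem_graph_iff]
  constructor
  · rintro ⟨hu, h⟩
    exact ⟨⟨u, hu⟩, rfl, h⟩
  · rintro ⟨⟨_, hu⟩, rfl, h⟩
    exact ⟨hu, h⟩

theorem IsFibreSymmetry.pullL20_mem_eigenspace {σ : Circ → Circ} (hσ : IsFibreSymmetry σ)
    {V : C(ℝ, ℝ)} {E : ℝ} {u : L20} (hu : u ∈ eigenspace V E) :
    pullL20 σ hσ.measurePreserving u ∈ eigenspace V E := by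
  rw [mem_eigenspace_iff] at hu ⊢
  rw [← map_smul]
  refine map_mem_graph_closure (fun x y hxy => ?_) hu
  rw [mem_graph_grushinMin] at hxy ⊢
  obtain ⟨f, rfl, rfl⟩ := hxy
  refine ⟨⟨f.1 ∘ fibreMap σ, hσ.isTest_comp f.1 f.2⟩, rfl, Subtype.ext ?_⟩
  have hm := (IsTest.grushinExpr V.continuous f.2).memLp
  exact MemLp.toLp_congr (IsTest.grushinExpr V.continuous (hσ.isTest_comp f.1 f.2)).memLp
    (hm.comp_measurePreserving (measurePreserving_fibreMap hσ.measurePreserving))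
    (Eventually.of_forall fun p => congrFun (hσ.grushinExpr_comp V f.1) p)

/-- `ker (P_V - E)` as a subspace of `L²(X)`. -/
def eigenspaceL2 (V : C(ℝ, ℝ)) (E : ℝ) : Submodule ℂ L2X := (eigenspace V E).map L20.subtype

theorem IsFibreSymmetry.pull_mem_eigenspaceL2 {σ : Circ → Circ} (hσ : IsFibreSymmetry σ)
    {V : C(ℝ, ℝ)} {E : ℝ} {u : L2X} (hu : u ∈ eigenspaceL2 V E) :
    pull σ hσ.measurePreserving u ∈ eigenspaceL2 V E := by
  obtain ⟨u, hu, rfl⟩ := hu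
  exact ⟨_, hσ.pullL20_mem_eigenspace hu, rfl⟩

theorem mem_L20_of_mem_eigenspaceL2 {V : C(ℝ, ℝ)} {E : ℝ} {u : L2X}
    (hu : u ∈ eigenspaceL2 V E) : u ∈ L20 := by
  obtain ⟨u, hu, rfl⟩ := hu
  exact u.2

theorem finrank_eigenspaceL2 (V : C(ℝ, ℝ)) (E : ℝ) :
    Module.finrank ℂ (eigenspaceL2 V E) = Module.finrank ℂ (eigenspace V E) :=
  (Submodule.equivMapOfInjective _ L20.injective_subtype _).finrank_eq.symm

/-! ### Rotations and their eigenfunctions -/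

/-- The rotation `u(x, y) ↦ u(x, y + t)` of `L²(X)`. -/
def rot (t : Circ) : L2X →ₗᵢ[ℂ] L2X := pull (· + t) (isFibreSymmetry_add t).measurePreserving

/-- The reflection `u(x, y) ↦ u(x, -y)` of `L²(X)`. -/
def refl : L2X →ₗᵢ[ℂ] L2X := pull Neg.neg isFibreSymmetry_neg.measurePreserving

theorem coeFn_rot (t : Circ) (u : L2X) :
    (rot t u : Cyl → ℂ) =ᵐ[volume] fun p => u (p.1, p.2 + t) := coeFn_pull _ u

theorem pull_pull {σ τ : Circ → Circ} (hσ : MeasurePreserving σ) (hτ : MeasurePreserving τ)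
    (u : L2X) : pull σ hσ (pull τ hτ u) = pull (τ ∘ σ) (hτ.comp hσ) u :=
  (Lp.compMeasurePreserving_comp_apply u (measurePreserving_fibreMap hτ)
    (measurePreserving_fibreMap hσ)).symm

theorem pull_congr {σ τ : Circ → Circ} (hσ : MeasurePreserving σ) (hτ : MeasurePreserving τ)
    (h : σ = τ) (u : L2X) : pull σ hσ u = pull τ hτ u := by
  subst h
  rfl

theorem rot_rot (s t : Circ) (u : L2X) : rot s (rot t u) = rot (t + s) u := by
  rw [rot, rot, rot, pull_pull]
  refine pull_congr _ _ (funext fun θ => ?_) u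
  simp only [Function.comp_apply]
  abel

theorem rot_zero (u : L2X) : rot 0 u = u := by
  refine Lp.ext ?_
  filter_upwards [coeFn_rot 0 u] with p h
  rw [h, add_zero]

theorem rot_refl (t : Circ) (u : L2X) : rot t (refl u) = refl (rot (-t) u) := by
  rw [rot, rot, refl, pull_pull, pull_pull]
  refine pull_congr _ _ (funext fun θ => ?_) u
  simp only [Function.comp_apply]
  abel

theorem continuous_rot (u : L2X) : Continuous fun t : Circ => rot t u := by
  let F : C(Circ × Cyl, Cyl) := ⟨fun q => fibreMap (· + q.1) q.2, by unfold fibreMap; fun_prop⟩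
  exact Continuous.compMeasurePreservingLp (continuous_const (y := u)) F.curry.continuous
    (fun t => measurePreserving_fibreMap (isFibreSymmetry_add t).measurePreserving) (by simp)

theorem fourier_add_apply (n : ℤ) (s t : Circ) :
    fourier n (s + t) = fourier n s * fourier n t := by
  simp [fourier_apply, AddCircle.toCircle_add]

theorem fourier_neg_mul_self (n : ℤ) (t : Circ) : fourier (-n) t * fourier n t = 1 := by
  rw [← fourier_add, neg_add_cancel, fourier_zero]

theorem norm_fourier_apply (n : ℤ) (t : Circ) : ‖fourier n t‖ = 1 := by
  rw [fourier_apply, Circle.norm_coe]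

/-- `u` transforms under rotations by the character `n`, that is, `u(x, y) = f(x) exp(i n y)`. -/
def IsMode (n : ℤ) (u : L2X) : Prop := ∀ t : Circ, rot t u = fourier n t • u

theorem IsMode.smul {n : ℤ} {u : L2X} (hu : IsMode n u) (c : ℂ) : IsMode n (c • u) := fun t => by
  rw [map_smul, hu t, smul_comm]

theorem IsMode.refl {n : ℤ} {u : L2X} (hu : IsMode n u) : IsMode (-n) (refl u) := fun t => by
  rw [rot_refl, hu (-t), map_smul]
  congr 1
  simp [fourier_apply]

theorem IsMode.ae_eq {n : ℤ} {u : L2X} (hu : IsMode n u) (t : Circ) :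
    ∀ᵐ p : Cyl, u (p.1, p.2 + t) = fourier n t * u p := by
  have h := coeFn_rot t u
  rw [hu t] at h
  filter_upwards [h, Lp.coeFn_smul (fourier n t) u] with p h1 h2
  rw [← h1, h2, Pi.smul_apply, smul_eq_mul]

/-- The average of `t ↦ exp(-i n t) u(x, y + t)` over the circle is a mode. -/
theorem isMode_fourierCoeff (u : L2X) (n : ℤ) : IsMode n (fourierCoeff (fun t => rot t u) n) := by
  intro s
  have h1 : ∀ t : Circ, rot s (fourier (-n) t • rot t u) =
      fourier n s • (fourier (-n) (t + s) • rot (t + s) u) := fun t => by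
    rw [map_smul, rot_rot, fourier_add_apply, smul_smul, mul_left_comm, mul_comm (fourier n s),
      fourier_neg_mul_self, mul_one]
  rw [fourierCoeff, ← LinearIsometry.integral_comp_comm]
  simp only [h1]
  rw [integral_smul]
  congr 1
  exact integral_add_right_eq_self (μ := AddCircle.haarAddCircle)
    (fun t => fourier (-n) t • rot t u) s

theorem inner_fourierCoeff (u : L2X) {f : Circ → L2X} (hf : Continuous f) (n : ℤ) :
    inner ℂ u (fourierCoeff f n) = fourierCoeff (fun t => inner ℂ u (f t)) n := by
  have hint : Integrable (fun t => fourier (-n) t • f t) AddCircle.haarAddCircle :=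
    Continuous.integrable_of_hasCompactSupport (by fun_prop) (HasCompactSupport.of_compactSpace _)
  have h := (innerSL ℂ u).integral_comp_comm hint
  simp only [innerSL_apply_apply, inner_smul_right] at h
  exact h.symm

theorem fourierCoeff_mem {K : Submodule ℂ L2X} (hK : IsClosed (K : Set L2X)) {f : Circ → L2X}
    (hf : Continuous f) (hfK : ∀ t, f t ∈ K) (n : ℤ) : fourierCoeff f n ∈ K :=
  Convex.integral_mem (K.restrictScalars ℝ).convex hK
    (Eventually.of_forall fun t => K.smul_mem _ (hfK t))
    (Continuous.integrable_of_hasCompactSupport (by fun_prop)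
      (HasCompactSupport.of_compactSpace _))

theorem eq_zero_of_fourierCoeff_eq_zero (f : C(Circ, ℂ)) (h : ∀ n, fourierCoeff f n = 0)
    (t : Circ) : f t = 0 := by
  have h0 : fourierCoeff f = 0 := funext h
  have h1 := has_pointwise_sum_fourier_series_of_summable (f := f) (h0 ▸ summable_zero) t
  simp only [h, zero_smul] at h1
  exact h1.unique hasSum_zero

/-- A nonzero closed rotation-invariant subspace contains a nonzero mode: otherwise all the
Fourier coefficients of `t ↦ ⟪φ, rot t φ⟫` would vanish. -/
theorem exists_isMode {K : Submodule ℂ L2X} (hc : IsClosed (K : Set L2X))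
    (hK : ∀ t, ∀ u ∈ K, rot t u ∈ K) {φ : L2X} (hφ : φ ∈ K) (h0 : φ ≠ 0) :
    ∃ n, ∃ u ∈ K, u ≠ 0 ∧ IsMode n u := by
  by_contra! hn
  have hz : ∀ n, fourierCoeff (fun t => rot t φ) n = 0 := fun n => by
    by_contra hne
    exact hn n _ (fourierCoeff_mem hc (continuous_rot φ) (fun t => hK t φ hφ) n) hne
      (isMode_fourierCoeff φ n)
  have hcont := continuous_rot φ
  let f : C(Circ, ℂ) := ⟨fun t => inner ℂ φ (rot t φ), by fun_prop⟩
  have hf := eq_zero_of_fourierCoeff_eq_zero f (fun n => by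
    rw [← inner_zero_right φ, ← hz n, inner_fourierCoeff φ (continuous_rot φ) n]
    rfl) 0
  have h1 : inner ℂ φ (rot 0 φ) = 0 := hf
  rw [rot_zero, inner_self_eq_zero] at h1
  exact h0 h1

theorem mem_xOnly_of_isMode_zero {u : L2X} (hu : IsMode 0 u) : u ∈ xOnly := by
  have hm : StronglyMeasurable (u : Cyl → ℂ) := Lp.stronglyMeasurable u
  have hm1 : Measurable fun q : Circ × Cyl => u (q.2.1, q.2.2 + q.1) :=
    hm.measurable.comp (by fun_prop)
  have hm2 : Measurable fun q : Circ × Cyl => u q.2 := hm.measurable.comp (by fun_prop)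
  have h1 : ∀ᵐ t : Circ, ∀ᵐ p : Cyl, u (p.1, p.2 + t) = u p :=
    Eventually.of_forall fun t => by simpa using hu.ae_eq t
  have h2 : ∀ᵐ p : Cyl, ∀ᵐ t : Circ, u (p.1, p.2 + t) = u p :=
    (Measure.ae_ae_comm (p := fun (t : Circ) (p : Cyl) => u (p.1, p.2 + t) = u p)
      (measurableSet_eq_fun hm1 hm2)).1 h1
  refine ⟨fun x => ((volume : Measure Circ).real Set.univ)⁻¹ • ∫ t : Circ, u (x, t), ?_⟩
  filter_upwards [h2] with p hp
  have h3 : ∫ t : Circ, u (p.1, t) = ∫ _ : Circ, u p := by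
    rw [← integral_add_left_eq_self (fun t : Circ => u (p.1, t)) p.2]
    exact integral_congr_ae hp
  have h4 : (volume : Measure Circ).real Set.univ ≠ 0 := by
    simp [Measure.real, AddCircle.measure_univ, Real.pi_pos.le, Real.pi_ne_zero]
  rw [h3, integral_const, inv_smul_smul₀ h4]

theorem IsMode.ne_zero {n : ℤ} {u : L2X} (hu : IsMode n u) (h : u ∈ L20) (h0 : u ≠ 0) :
    n ≠ 0 := by
  rintro rfl
  exact h0 (inner_self_eq_zero.1 ((Submodule.mem_orthogonal _ _).1 h u
    (mem_xOnly_of_isMode_zero hu)))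

/-- Modes for distinct characters are orthogonal. -/
theorem IsMode.inner_eq_zero {n m : ℤ} {u v : L2X} (hu : IsMode n u) (hv : IsMode m v)
    (h : n ≠ m) : inner ℂ u v = 0 := by
  have h1 : ∀ t : Circ, inner ℂ u v = fourier (m - n) t * inner ℂ u v := fun t => by
    conv_lhs => rw [← (rot t).inner_map_map, hu t, hv t, inner_smul_left, inner_smul_right,
      ← fourier_neg, ← mul_assoc, ← fourier_add, neg_add_eq_sub]
  have h2 := fourier_add_half_inv_index (sub_ne_zero.2 h.symm) Real.two_pi_pos 0
  have h3 := h1 (0 + ((2 * Real.pi / 2 / (m - n : ℤ) : ℝ) : Circ))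
  rw [h2, fourier_eval_zero, neg_one_mul] at h3
  exact self_eq_neg.1 h3

/-! ### Integrals of weighted products of modes -/

/-- Averaging over rotations: the integral of a function of character `m` against a weight that
depends only on the angle sees only one Fourier coefficient of the weight. -/
theorem integral_weight_mul {F : Cyl → ℂ} (hF : Integrable F) {m : ℤ}
    (hm : ∀ t : Circ, ∀ᵐ p : Cyl, F (p.1, p.2 + t) = fourier m t * F p)
    {g : Circ → ℂ} (hg : Measurable g) (hg1 : ∀ θ, ‖g θ‖ ≤ 1) :
    ∫ p : Cyl, g p.2 * F p = fourierCoeff g (-m) * ∫ p : Cyl, fourier (-m) p.2 * F p := by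
  have h1 : ∀ t : Circ, ∫ p : Cyl, g p.2 * F p =
      ∫ p : Cyl, g (p.2 + t) * fourier m t * F p := fun t => by
    have hmp := measurePreserving_fibreMap (isFibreSymmetry_add t).measurePreserving
    have he : MeasurableEmbedding (fibreMap (· + t)) :=
      ((Homeomorph.refl ℝ).prodCongr (Homeomorph.addRight t)).measurableEmbedding
    rw [← hmp.integral_comp he]
    refine integral_congr_ae ?_
    filter_upwards [hm t] with p hp
    simp only [fibreMap]
    rw [hp, mul_assoc]
  have hint : Integrable (Function.uncurry fun (t : Circ) (p : Cyl) =>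
      g (p.2 + t) * fourier m t * F p) (AddCircle.haarAddCircle.prod volume) := by
    refine (hF.comp_snd AddCircle.haarAddCircle).bdd_mul (c := 1)
      (f := fun q : Circ × Cyl => g (q.2.2 + q.1) * fourier m q.1) ?_ ?_
    · have h2 : Measurable fun q : Circ × Cyl => g (q.2.2 + q.1) := hg.comp (by fun_prop)
      have h3 : Measurable fun q : Circ × Cyl => fourier m q.1 :=
        (map_continuous (fourier m)).measurable.comp measurable_fst
      exact (h2.mul h3).aestronglyMeasurable
    · refine Eventually.of_forall fun q => ?_
      rw [norm_mul, norm_fourier_apply, mul_one]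
      exact hg1 _
  have h2 : ∀ θ : Circ, ∫ t : Circ, g (θ + t) * fourier m t ∂AddCircle.haarAddCircle =
      fourierCoeff g (-m) * fourier (-m) θ := fun θ => by
    have h3 := integral_add_left_eq_self (μ := AddCircle.haarAddCircle)
      (fun t : Circ => fourier m t * g t) θ
    rw [fourierCoeff, neg_neg, ← integral_mul_const]
    simp only [smul_eq_mul]
    rw [integral_mul_const, ← h3, ← integral_mul_const]
    refine integral_congr_ae (Eventually.of_forall fun t => ?_)
    simp only [fourier_add_apply]
    linear_combination (- g (θ + t) * fourier m t) * fourier_neg_mul_self m θ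
  calc ∫ p : Cyl, g p.2 * F p
      = ∫ _ : Circ, (∫ p : Cyl, g p.2 * F p) ∂AddCircle.haarAddCircle := by simp
    _ = ∫ t : Circ, (∫ p : Cyl, g (p.2 + t) * fourier m t * F p) ∂AddCircle.haarAddCircle :=
        integral_congr_ae (Eventually.of_forall h1)
    _ = ∫ p : Cyl, (∫ t : Circ, g (p.2 + t) * fourier m t * F p ∂AddCircle.haarAddCircle) :=
        integral_integral_swap hint
    _ = ∫ p : Cyl, fourierCoeff g (-m) * (fourier (-m) p.2 * F p) := by
        refine integral_congr_ae (Eventually.of_forall fun p => ?_)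
        beta_reduce
        rw [integral_mul_const, h2, mul_assoc]
    _ = _ := integral_const_mul _ _

/-- The sesquilinear pairing of `u` and `v` weighted by a function `g` of the angle. -/
def weighted (g : Circ → ℂ) (u v : L2X) : ℂ := ∫ p : Cyl, g p.2 * inner ℂ (u p) (v p)

theorem integrable_weighted {g : Circ → ℂ} (hg : Measurable g) (hg1 : ∀ θ, ‖g θ‖ ≤ 1)
    (u v : L2X) : Integrable fun p : Cyl => g p.2 * inner ℂ (u p) (v p) :=
  (L2.integrable_inner u v).bdd_mul (c := 1)
    (hg.comp measurable_snd).aestronglyMeasurable (Eventually.of_forall fun p => hg1 p.2)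

theorem weighted_add_add {g : Circ → ℂ} (hg : Measurable g) (hg1 : ∀ θ, ‖g θ‖ ≤ 1)
    (u v : L2X) : weighted g (u + v) (u + v) =
      weighted g u u + weighted g u v + (weighted g v u + weighted g v v) := by
  have hi := integrable_weighted hg hg1
  have h := integral_add ((hi u u).add (hi u v)) ((hi v u).add (hi v v))
  rw [integral_add' (hi u u) (hi u v), integral_add' (hi v u) (hi v v)] at h
  simp only [weighted]
  rw [← h]
  refine integral_congr_ae ?_
  filter_upwards [Lp.coeFn_add u v] with p hp
  simp only [hp, Pi.add_apply, inner_add_left, inner_add_right]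
  ring

theorem norm_weighted_le {g : Circ → ℂ} (hg : Measurable g) (hg1 : ∀ θ, ‖g θ‖ ≤ 1)
    (u v : L2X) : ‖weighted g u v‖ ≤ ‖u‖ * ‖v‖ := by
  have hm : MemLp (fun p : Cyl => g p.2 * v p) 2 volume :=
    (Lp.memLp v).of_le ((hg.comp measurable_snd).aestronglyMeasurable.mul
      (Lp.aestronglyMeasurable v)) (Eventually.of_forall fun p => by
        rw [norm_mul]
        exact mul_le_of_le_one_left (norm_nonneg _) (hg1 _))
  have h1 : weighted g u v = inner ℂ u (hm.toLp _) := by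
    rw [L2.inner_def]
    refine integral_congr_ae ?_
    filter_upwards [hm.coeFn_toLp] with p hp
    rw [hp, ← smul_eq_mul (g p.2) (v p), inner_smul_right]
  have h2 : ‖hm.toLp _‖ ≤ ‖v‖ := by
    refine Lp.norm_le_norm_of_ae_le ?_
    filter_upwards [hm.coeFn_toLp] with p hp
    rw [hp, norm_mul]
    exact mul_le_of_le_one_left (norm_nonneg _) (hg1 _)
  rw [h1]
  exact (norm_inner_le_norm _ _).trans (mul_le_mul_of_nonneg_left h2 (norm_nonneg _))

theorem weighted_fourier_eq {k n : ℤ} {u v : L2X} (hu : IsMode k u) (hv : IsMode n v)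
    {g : Circ → ℂ} (hg : Measurable g) (hg1 : ∀ θ, ‖g θ‖ ≤ 1) :
    weighted g u v = fourierCoeff g (-(n - k)) * weighted (fourier (-(n - k))) u v := by
  refine integral_weight_mul (L2.integrable_inner u v) (fun t => ?_) hg hg1
  filter_upwards [hu.ae_eq t, hv.ae_eq t] with p h1 h2
  rw [h1, h2, ← smul_eq_mul (fourier k t), ← smul_eq_mul (fourier n t), inner_smul_left, inner_smul_right, ← fourier_neg,
    ← mul_assoc, ← fourier_add, neg_add_eq_sub]

theorem weighted_self {n : ℤ} {u : L2X} (hu : IsMode n u)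
    {g : Circ → ℂ} (hg : Measurable g) (hg1 : ∀ θ, ‖g θ‖ ≤ 1) :
    weighted g u u = fourierCoeff g 0 * (‖u‖ : ℂ) ^ 2 := by
  rw [weighted_fourier_eq hu hu hg hg1, sub_self, neg_zero, weighted]
  simp only [fourier_zero, one_mul]
  rw [← L2.inner_def, inner_self_eq_norm_sq_to_K]
  rfl

theorem norm_weighted_mode_le {k n : ℤ} {u v : L2X} (hu : IsMode k u) (hv : IsMode n v)
    {g : Circ → ℂ} (hg : Measurable g) (hg1 : ∀ θ, ‖g θ‖ ≤ 1) :
    ‖weighted g u v‖ ≤ ‖fourierCoeff g (k - n)‖ * (‖u‖ * ‖v‖) := by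
  rw [weighted_fourier_eq hu hv hg hg1, norm_mul, neg_sub]
  exact mul_le_mul_of_nonneg_left
    (norm_weighted_le (map_continuous _).measurable (fun θ => (norm_fourier_apply _ θ).le) u v)
    (norm_nonneg _)

/-- Lower bound for the weighted norm of a sum of two opposite modes, when the Fourier coefficients
of the weight that govern the cross terms are smaller than its mean. -/
theorem weighted_add_ge {n : ℤ} (hn : n ≠ 0) {u v : L2X} (hu : IsMode n u) (hv : IsMode (-n) v)
    {g : Circ → ℂ} (hg : Measurable g) (hg1 : ∀ θ, ‖g θ‖ ≤ 1) {c : ℝ}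
    (hc1 : ‖fourierCoeff g (2 * n)‖ + c ≤ (fourierCoeff g 0).re)
    (hc2 : ‖fourierCoeff g (-(2 * n))‖ + c ≤ (fourierCoeff g 0).re) :
    c * ‖u + v‖ ^ 2 ≤ (weighted g (u + v) (u + v)).re := by
  have hperp : ‖u + v‖ ^ 2 = ‖u‖ ^ 2 + ‖v‖ ^ 2 := by
    have h := norm_add_sq_eq_norm_sq_add_norm_sq_of_inner_eq_zero u v
      (hu.inner_eq_zero hv (by omega))
    simpa only [pow_two] using h
  have h1 := norm_weighted_mode_le hu hv hg hg1
  have h2 := norm_weighted_mode_le hv hu hg hg1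
  rw [show n - -n = 2 * n by ring] at h1
  rw [show -n - n = -(2 * n) by ring] at h2
  have h3 := neg_le_of_abs_le (Complex.abs_re_le_norm (weighted g u v))
  have h4 := neg_le_of_abs_le (Complex.abs_re_le_norm (weighted g v u))
  have hre : ∀ w : L2X, (fourierCoeff g 0 * (‖w‖ : ℂ) ^ 2).re =
      (fourierCoeff g 0).re * ‖w‖ ^ 2 := fun w => by
    rw [← Complex.ofReal_pow, Complex.re_mul_ofReal]
  rw [weighted_add_add hg hg1, weighted_self hu hg hg1, weighted_self hv hg hg1, hperp]
  simp only [Complex.add_re, hre]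
  have hs : 0 ≤ ‖u‖ * ‖v‖ := by positivity
  have h5 := mul_le_mul_of_nonneg_right hc1 hs
  have h6 := mul_le_mul_of_nonneg_right hc2 hs
  have h7 : c ≤ (fourierCoeff g 0).re := by linarith [norm_nonneg (fourierCoeff g (2 * n))]
  -- The cross terms are absorbed by `2 ‖u‖ ‖v‖ ≤ ‖u‖ ^ 2 + ‖v‖ ^ 2`.
  nlinarith [mul_nonneg (sub_nonneg.2 h7) (sq_nonneg (‖u‖ - ‖v‖))]

/-! ### Fourier coefficients of an arc -/

/-- The indicator function of the image in the circle of the interval `]a, b[`. -/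
def arc (a b : ℝ) : Circ → ℂ :=
  Set.indicator ((fun t : ℝ => (t : Circ)) '' Set.Ioo a b) fun _ => 1

theorem isOpen_arc (a b : ℝ) : IsOpen ((fun t : ℝ => (t : Circ)) '' Set.Ioo a b) :=
  QuotientAddGroup.isOpenMap_coe _ isOpen_Ioo

theorem measurable_arc (a b : ℝ) : Measurable (arc a b) :=
  measurable_const.indicator (isOpen_arc a b).measurableSet

theorem norm_arc_le (a b : ℝ) (θ : Circ) : ‖arc a b θ‖ ≤ 1 := by
  unfold arc
  refine (norm_indicator_le_norm_self _ θ).trans ?_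
  simp

theorem arc_coe {a b : ℝ} (hb : b ≤ a + 2 * Real.pi) {y : ℝ}
    (hy : y ∈ Set.Ioc a (a + 2 * Real.pi)) :
    arc a b (y : Circ) = (Set.Ioo a b).indicator (fun _ => (1 : ℂ)) y := by
  have h : ((y : Circ) ∈ (fun t : ℝ => (t : Circ)) '' Set.Ioo a b) ↔ y ∈ Set.Ioo a b := by
    refine ⟨?_, fun h => ⟨y, h, rfl⟩⟩
    rintro ⟨z, hz, hzy⟩
    have h1 := (AddCircle.coe_eq_coe_iff_of_mem_Ioc (p := 2 * Real.pi) (a := a)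
      ⟨hz.1, hz.2.le.trans hb⟩ hy).1 hzy
    exact h1 ▸ hz
  by_cases hy' : y ∈ Set.Ioo a b
  · rw [arc, Set.indicator_of_mem (h.2 hy'), Set.indicator_of_mem hy']
  · rw [arc, Set.indicator_of_notMem (fun h' => hy' (h.1 h')), Set.indicator_of_notMem hy']

theorem fourierCoeff_arc {a b : ℝ} (hab : a ≤ b) (hb : b ≤ a + 2 * Real.pi) (n : ℤ) :
    fourierCoeff (arc a b) n =
      (2 * Real.pi)⁻¹ • ∫ y in a..b, fourier (-n) (y : Circ) := by
  rw [fourierCoeff_eq_intervalIntegral _ _ a, one_div]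
  congr 1
  rw [intervalIntegral.integral_of_le (by linarith [Real.pi_pos]),
    intervalIntegral.integral_of_le hab, integral_Ioc_eq_integral_Ioo (x := a) (y := b),
    ← integral_indicator measurableSet_Ioo, ← integral_indicator measurableSet_Ioc]
  refine integral_congr_ae (Eventually.of_forall fun y => ?_)
  have hsub : Set.Ioo a b ⊆ Set.Ioc a (a + 2 * Real.pi) := fun z hz => ⟨hz.1, hz.2.le.trans hb⟩
  by_cases hy : y ∈ Set.Ioc a (a + 2 * Real.pi)
  · simp only [Set.indicator_of_mem hy, arc_coe hb hy]
    by_cases hy' : y ∈ Set.Ioo a b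
    · simp only [Set.indicator_of_mem hy', smul_eq_mul, mul_one]
    · simp only [Set.indicator_of_notMem hy', smul_zero]
  · simp only [Set.indicator_of_notMem hy, Set.indicator_of_notMem fun h => hy (hsub h)]

theorem abs_sin_nat_mul_le (n : ℕ) (x : ℝ) : |Real.sin (n * x)| ≤ n * |Real.sin x| := by
  induction n with
  | zero => simp
  | succ n ih =>
    push_cast
    rw [add_one_mul, Real.sin_add, add_one_mul]
    refine (abs_add_le _ _).trans (add_le_add ?_ ?_)
    · rw [abs_mul]
      exact (mul_le_of_le_one_right (abs_nonneg _) (Real.abs_cos_le_one _)).trans ih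
    · rw [abs_mul]
      exact mul_le_of_le_one_left (abs_nonneg _) (Real.abs_cos_le_one _)

theorem abs_sin_int_mul_le (n : ℤ) (x : ℝ) : |Real.sin (n * x)| ≤ |(n : ℝ)| * |Real.sin x| := by
  rcases Int.natAbs_eq n with h | h <;> rw [h]
  · simpa using abs_sin_nat_mul_le n.natAbs x
  · simpa using abs_sin_nat_mul_le n.natAbs x

theorem exp_add_sub_exp_sub (x y : ℂ) :
    Complex.exp (x + y * Complex.I) - Complex.exp (x - y * Complex.I) =
      Complex.exp x * (2 * Complex.sin y) * Complex.I := by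
  rw [Complex.two_sin, sub_eq_add_neg x, Complex.exp_add, Complex.exp_add, ← neg_mul]
  linear_combination (-Complex.exp x * (Complex.exp (-y * Complex.I) -
    Complex.exp (y * Complex.I))) * Complex.I_sq

theorem fourier_two_mul_coe (n : ℤ) (y : ℝ) :
    fourier (2 * n) (y : Circ) = Complex.exp (2 * n * Complex.I * y) := by
  rw [fourier_coe_apply]
  have h := Complex.ofReal_ne_zero.2 Real.pi_ne_zero
  congr 1
  push_cast
  field_simp

/-- The left side equals `|sin (n (b - a))| / |n|`; bounding it by `|sin (b - a)|` makes the estimate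
uniform in the frequency. -/
theorem norm_integral_fourier_le {n : ℤ} (hn : n ≠ 0) (a b : ℝ) :
    ‖∫ y in a..b, fourier (2 * n) (y : Circ)‖ ≤ |Real.sin (b - a)| := by
  have hc : (2 * n * Complex.I : ℂ) ≠ 0 := by simp [hn]
  simp only [fourier_two_mul_coe]
  rw [integral_exp_mul_complex hc]
  have h2 := exp_add_sub_exp_sub (((n * (a + b) : ℝ) : ℂ) * Complex.I) ((n * (b - a) : ℝ) : ℂ)
  rw [show ((n * (a + b) : ℝ) : ℂ) * Complex.I + ((n * (b - a) : ℝ) : ℂ) * Complex.I =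
      2 * n * Complex.I * b by push_cast; ring,
    show ((n * (a + b) : ℝ) : ℂ) * Complex.I - ((n * (b - a) : ℝ) : ℂ) * Complex.I =
      2 * n * Complex.I * a by push_cast; ring, ← Complex.ofReal_sin] at h2
  have hn' : 0 < |(n : ℝ)| := by simpa using hn
  rw [h2]
  simp only [norm_div, norm_mul, Complex.norm_exp_ofReal_mul_I, Complex.norm_I, Complex.norm_real,
    Complex.norm_intCast, Real.norm_eq_abs, Complex.norm_ofNat, one_mul, mul_one]
  rw [mul_div_mul_left _ _ two_ne_zero, div_le_iff₀ hn', mul_comm |Real.sin (b - a)|]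
  exact abs_sin_int_mul_le n _

theorem norm_fourierCoeff_arc_le {a b : ℝ} (hab : a ≤ b) (hb : b ≤ a + 2 * Real.pi) {n : ℤ}
    (hn : n ≠ 0) :
    ‖fourierCoeff (arc a b) (2 * n)‖ ≤ (2 * Real.pi)⁻¹ * |Real.sin (b - a)| := by
  rw [fourierCoeff_arc hab hb, norm_smul, Real.norm_of_nonneg (by positivity [Real.pi_pos])]
  gcongr
  rw [show -(2 * n) = 2 * -n by ring]
  exact norm_integral_fourier_le (neg_ne_zero.2 hn) a b

theorem fourierCoeff_arc_zero {a b : ℝ} (hab : a ≤ b) (hb : b ≤ a + 2 * Real.pi) :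
    (fourierCoeff (arc a b) 0).re = (2 * Real.pi)⁻¹ * (b - a) := by
  rw [fourierCoeff_arc hab hb]
  simp

/-! ### The observability estimate -/

/-- An eigenspace of dimension two consists of the sums of two opposite nonconstant modes. -/
theorem exists_add_of_mem_eigenspaceL2 {V : C(ℝ, ℝ)} {E : ℝ}
    (h2 : Module.finrank ℂ (eigenspaceL2 V E) = 2) {φ : L2X} (hφ : φ ∈ eigenspaceL2 V E) :
    ∃ n : ℤ, n ≠ 0 ∧ ∃ u v : L2X, IsMode n u ∧ IsMode (-n) v ∧ φ = u + v := by
  by_cases h0 : φ = 0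
  · subst h0
    exact ⟨1, one_ne_zero, 0, 0, fun t => by simp, fun t => by simp, by simp⟩
  have hfin : FiniteDimensional ℂ (eigenspaceL2 V E) :=
    Module.finite_of_finrank_pos (by omega)
  obtain ⟨n, u, hu, hu0, hun⟩ := exists_isMode (eigenspaceL2 V E).closed_of_finiteDimensional
    (fun t u hu => (isFibreSymmetry_add t).pull_mem_eigenspaceL2 hu) hφ h0
  have hn : n ≠ 0 := hun.ne_zero (mem_L20_of_mem_eigenspaceL2 hu) hu0
  have hv : refl u ∈ eigenspaceL2 V E := isFibreSymmetry_neg.pull_mem_eigenspaceL2 hu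
  have hv0 : refl u ≠ 0 := fun h => hu0 (Grushin.refl.injective (h.trans (map_zero _).symm))
  have horth : inner ℂ u (refl u) = 0 := hun.inner_eq_zero hun.refl (by omega)
  have hli : LinearIndependent ℂ ![u, refl u] := by
    rw [LinearIndependent.pair_iff]
    intro s t hst
    have h3 : inner ℂ u (s • u + t • refl u) = 0 := by rw [hst, inner_zero_right]
    rw [inner_add_right, inner_smul_right, inner_smul_right, horth, mul_zero, add_zero,
      mul_eq_zero, inner_self_eq_zero, or_iff_left hu0] at h3
    subst h3
    rw [zero_smul, zero_add, smul_eq_zero, or_iff_left hv0] at hst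
    exact ⟨rfl, hst⟩
  have hspan : Submodule.span ℂ {u, refl u} = eigenspaceL2 V E := by
    refine Submodule.eq_of_le_of_finrank_eq ?_ ?_
    · rw [Submodule.span_le]
      rintro w (rfl | rfl)
      exacts [hu, hv]
    · have h4 := finrank_span_eq_card hli
      rw [Matrix.range_cons_cons_empty] at h4
      rw [h4, h2, Fintype.card_fin]
  rw [← hspan, Submodule.mem_span_pair] at hφ
  obtain ⟨s, t, rfl⟩ := hφ
  exact ⟨n, hn, s • u, t • refl u, hun.smul s, hun.refl.smul t, rfl⟩

theorem eLpNorm_eq_ofReal_sqrt (u : L2X) (A : Set Cyl) :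
    eLpNorm u 2 (volume.restrict A) =
      ENNReal.ofReal √(∫ p in A, ‖u p‖ ^ 2) := by
  rw [((Lp.memLp u).restrict A).eLpNorm_eq_integral_rpow_norm two_ne_zero ENNReal.ofNat_ne_top,
    Real.sqrt_eq_rpow]
  simp

theorem weighted_arc (a b : ℝ) (u : L2X) :
    (weighted (arc a b) u u).re = ∫ p in strip a b, ‖u p‖ ^ 2 := by
  have hs : MeasurableSet (strip a b) := measurable_snd (isOpen_arc a b).measurableSet
  rw [← integral_indicator hs, ← RCLike.re_eq_complex_re, weighted,
    ← integral_re (integrable_weighted (measurable_arc a b) (norm_arc_le a b) u u)]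
  refine integral_congr_ae (Eventually.of_forall fun p => ?_)
  by_cases hp : p ∈ strip a b
  · have hp' : p.2 ∈ (fun t : ℝ => (t : Circ)) '' Set.Ioo a b := hp
    simp only [arc, Set.indicator_of_mem hp, Set.indicator_of_mem hp', one_mul]
    exact inner_self_eq_norm_sq _
  · have hp' : p.2 ∉ (fun t : ℝ => (t : Circ)) '' Set.Ioo a b := hp
    simp [arc, Set.indicator_of_notMem hp, Set.indicator_of_notMem hp']

/-- The estimate on a strip of width at most `2π`. -/
theorem norm_le_strip {n : ℤ} (hn : n ≠ 0) {u v : L2X} (hu : IsMode n u) (hv : IsMode (-n) v)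
    {a b : ℝ} (hab : a ≤ b) (hb : b ≤ a + 2 * Real.pi) :
    (2 * Real.pi)⁻¹ * (b - a - |Real.sin (b - a)|) * ‖u + v‖ ^ 2 ≤
      ∫ p in strip a b, ‖(u + v : L2X) p‖ ^ 2 := by
  rw [← weighted_arc]
  have h1 := norm_fourierCoeff_arc_le hab hb hn
  have h2 := norm_fourierCoeff_arc_le hab hb (neg_ne_zero.2 hn)
  rw [mul_neg] at h2
  refine weighted_add_ge hn hu hv (measurable_arc a b) (norm_arc_le a b) ?_ ?_ <;>
    rw [fourierCoeff_arc_zero hab hb, mul_sub] <;> linarith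

end Grushin

end

theorem mainTheorem2 (V : C(ℝ, ℝ)) (hV_nonneg : ∀ x, 0 ≤ V x)
    (hV_lim : Tendsto V (cocompact ℝ) atTop)
    (hmult : ∀ E : ℝ, Grushin.IsEigenvalue V E → Module.finrank ℂ (Grushin.eigenspace V E) = 2)
    (a b : ℝ) (hab : a < b) :
    ∃ C : ℝ, 0 < C ∧ ∀ E : ℝ, ∀ φ ∈ Grushin.eigenspace V E,
      eLpNorm ((φ : Grushin.L2X) : Grushin.Cyl → ℂ) 2 volume ≤
        ENNReal.ofReal C *
          eLpNorm ((φ : Grushin.L2X) : Grushin.Cyl → ℂ) 2 (volume.restrict (Grushin.strip a b)) := by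
  -- Only a substrip of width at most `2π` is used, so that it covers no point of the
  -- cylinder twice.
  obtain ⟨b', hab', hb'b, hb'⟩ : ∃ b', a < b' ∧ b' ≤ b ∧ b' ≤ a + 2 * Real.pi :=
    ⟨min b (a + 2 * Real.pi), lt_min hab (by linarith [Real.pi_pos]), min_le_left _ _,
      min_le_right _ _⟩
  have hsin : |Real.sin (b' - a)| < b' - a := by
    simpa [abs_of_pos (sub_pos.2 hab')] using Real.abs_sin_lt_abs (sub_pos.2 hab').ne'
  obtain ⟨c, hc, hc0⟩ : ∃ c, c = (2 * Real.pi)⁻¹ * (b' - a - |Real.sin (b' - a)|) ∧ 0 < c :=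
    ⟨_, rfl, mul_pos (inv_pos.2 Real.two_pi_pos) (sub_pos.2 hsin)⟩
  refine ⟨√(c⁻¹), Real.sqrt_pos.2 (inv_pos.2 hc0), fun E φ hφ => ?_⟩
  have hmem : (φ : Grushin.L2X) ∈ Grushin.eigenspaceL2 V E := ⟨φ, hφ, rfl⟩
  have hest : c * ‖(φ : Grushin.L2X)‖ ^ 2 ≤
      ∫ p in Grushin.strip a b', ‖(φ : Grushin.L2X) p‖ ^ 2 := by
    by_cases h0 : φ = 0
    · subst h0
      simp only [ZeroMemClass.coe_zero, norm_zero]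
      rw [zero_pow two_ne_zero, mul_zero]
      exact integral_nonneg fun p => by positivity
    · have hE : Grushin.IsEigenvalue V E := fun h => h0 (by simpa [h] using hφ)
      obtain ⟨n, hn, u, v, hu, hv, he⟩ := Grushin.exists_add_of_mem_eigenspaceL2
        ((Grushin.finrank_eigenspaceL2 V E).trans (hmult E hE)) hmem
      rw [he, hc]
      exact Grushin.norm_le_strip hn hu hv hab'.le hb'
  have hsub : Grushin.strip a b' ⊆ Grushin.strip a b :=
    Set.preimage_mono (Set.image_mono (Set.Ioo_subset_Ioo_right hb'b))
  calc eLpNorm ((φ : Grushin.L2X) : Grushin.Cyl → ℂ) 2 volume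
      = ENNReal.ofReal ‖(φ : Grushin.L2X)‖ := by
        rw [Lp.norm_def, ENNReal.ofReal_toReal (Lp.eLpNorm_ne_top _)]
    _ ≤ ENNReal.ofReal (√(c⁻¹) *
          √(∫ p in Grushin.strip a b', ‖(φ : Grushin.L2X) p‖ ^ 2)) := by
        refine ENNReal.ofReal_le_ofReal ?_
        rw [← Real.sqrt_mul (inv_pos.2 hc0).le]
        refine Real.le_sqrt_of_sq_le ?_
        rwa [inv_mul_eq_div, le_div_iff₀' hc0]
    _ = ENNReal.ofReal √(c⁻¹) * eLpNorm ((φ : Grushin.L2X) : Grushin.Cyl → ℂ) 2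
          (volume.restrict (Grushin.strip a b')) := by
        rw [ENNReal.ofReal_mul (Real.sqrt_nonneg _), Grushin.eLpNorm_eq_ofReal_sqrt]
    _ ≤ _ := by
        gcongr
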